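/- Let $m\ge 0$ be an integer. A matching of $[2m]=\{1,2,\dots,2m\}$ is a partition of $[2m]$ all of whose blocks have exactly two elements; its arcs are the pairs $(i,j)$ with $i<j$ such that $\{i,j\}$ is a block. For $k\ge 2$, a matching is $k$-noncrossing if it has no $k$ arcs $(i_1,j_1),\dots,(i_k,j_k)$ with $i_1<i_2<\cdots<i_k<j_1<j_2<\cdots<j_k$. A Dyck path of length $2m$ is a lattice path in the plane from $(0,0)$ to $(2m,0)$ with steps $(1,1)$ and $(1,-1)$ that never passes below the $x$-axis. An ordered pair $(P,Q)$ of Dyck paths of length $2m$ is noncrossing if $P$ never goes below $Q$. Then: 1. The set of $2$-noncrossing matchings of $[2m]$ is in one-to-one correspondence with the set of Dyck paths of length $2m$. 2. The set of $3$-noncrossing matchings of $[2m]$ is in one-to-one correspondence with the set of noncrossing pairs $(P,Q)$ of Dyck paths of length $2m$. -/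

import Mathlib

/-- The set `[2m] = {1, 2, …, 2m}`. -/
abbrev groundSet (m : ℕ) : Finset ℕ := Finset.Icc 1 (2 * m)

/-- A set partition of `[2m]` is a (complete) matching if all its blocks have two elements. -/
def IsCompleteMatching {m : ℕ} (M : Finpartition (groundSet m)) : Prop :=
  ∀ B ∈ M.parts, B.card = 2

/-- `(i, j)` is an arc of `M`: `i < j` and `{i, j}` is a block of `M`. -/
def IsArc {m : ℕ} (M : Finpartition (groundSet m)) (i j : ℕ) : Prop :=
  i < j ∧ ({i, j} : Finset ℕ) ∈ M.parts

/-- `M` has a `k`-crossing: there are `k` arcs `(i 0, j 0), …, (i (k-1), j (k-1))` of `M` with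
`i 0 < ⋯ < i (k-1) < j 0 < ⋯ < j (k-1)`. -/
def HasCrossing {m : ℕ} (k : ℕ) (M : Finpartition (groundSet m)) : Prop :=
  ∃ i j : Fin k → ℕ, (∀ r, IsArc M (i r) (j r)) ∧
    StrictMono i ∧ (∀ r s, i r < j s) ∧ StrictMono j

/-- The `k`-noncrossing matchings of `[2m]`. -/
def NoncrossingMatching (k m : ℕ) : Type :=
  {M : Finpartition (groundSet m) // IsCompleteMatching M ∧ ¬ HasCrossing k M}

/-- A Dyck path of length `2m`: a lattice path in the plane from `(0, 0)` to `(2m, 0)` with steps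
`(1, 1)` and `(1, -1)` that never passes below the `x`-axis, given by its successive points. -/
structure DyckPath (m : ℕ) where
  point : Fin (2 * m + 1) → ℤ × ℤ
  origin : point 0 = (0, 0)
  destination : point (Fin.last (2 * m)) = (2 * (m : ℤ), 0)
  step : ∀ t : Fin (2 * m),
    point t.succ = point t.castSucc + (1, 1) ∨ point t.succ = point t.castSucc + (1, -1)
  nonneg : ∀ t, 0 ≤ (point t).2

/-- The pairs `(P, Q)` of noncrossing Dyck paths of length `2m`: `P` never goes below `Q`.
(Both paths run from `(0, 0)` to `(2m, 0)`, and the `t`-th point of either has abscissa `t`.) -/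
def NoncrossingDyckPair (m : ℕ) : Type :=
  {PQ : DyckPath m × DyckPath m // ∀ t, (PQ.2.point t).2 ≤ (PQ.1.point t).2}

/-! Read a matching from left to right. At each moment list the pending openers in the order of
their closing, and keep a standard tableau with one entry per pending opener, the opener closing
first having the largest entry. An opener is row-inserted at the rank of its closing time; a closer
deletes the largest entry. The shapes met on the way form an oscillating tableau from the empty
shape to itself. If the rows have lengths `a ≥ b`, then `a + b` and `a - b` change by one at each
step and satisfy `0 ≤ a - b ≤ a + b`: they are the heights of `P` and `Q`.

Two rows suffice exactly when there is no 3-crossing. The new opener is the largest so far, so a new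
3-crossing comes from two pending openers that increase among the `p` closing before it
(`completedCrossing_open`, `hasIncreasing_two`). Insertion would reach a third row when, among the
`p` largest entries, some second-row entry exceeds a first-row one. `SameProfile` makes these two
obstructions agree and survives every step: it says that the list and the tableau word have the same
descents.

The process is reversible. The last change of shape tells whether to restore a deleted entry or to
undo an insertion, and in which row; reverse insertion exists and is unique (`exists_rowOneInsert`,
`exists_rowTwoInsert`, `source_unique`). So `TableauRun` relates matchings and pairs bijectively.

A 2-crossing appears exactly when an opener is inserted at `p > 0`. This either bumps an entry or
requires a second row already present, so 2-noncrossing means that the second row is never used,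
that is `P = Q`. -/

/-! ### Two-row tableaux as ballot words, and row insertion -/

/-- The sign of a step, `1` for `true` and `-1` for `false`. -/
def stepSign (b : Bool) : ℤ := bif b then 1 else -1

/-- The number of `true`s minus the number of `false`s. -/
def excess : List Bool → ℤ
  | [] => 0
  | c :: w => stepSign c + excess w

/-- All suffixes have nonnegative excess. Such a word encodes a standard tableau with at most two
rows: the letter of an entry is `true` if the entry lies in the first row, and deleting the head
of the word deletes the extremal entry. -/
def Ballot : List Bool → Prop
  | [] => True
  | c :: w => Ballot w ∧ 0 ≤ excess (c :: w)

theorem Ballot.excess_nonneg : ∀ {w : List Bool}, Ballot w → 0 ≤ excess w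
  | [], _ => le_rfl
  | _ :: _, h => h.2

/-- Insertion at position `p` into a two-row tableau that adds a box to the first row. -/
inductive RowOneInsert : List Bool → ℕ → List Bool → Prop
  | here (s) : RowOneInsert s 0 (true :: s)
  | skip {s p s'} : RowOneInsert s p s' → RowOneInsert (false :: s) (p + 1) (false :: s')

/-- Insertion at position `p` into a two-row tableau that bumps an entry to the second row. -/
inductive RowTwoInsert : List Bool → ℕ → List Bool → Prop
  | bump {s p s'} : RowOneInsert s p s' → RowTwoInsert (true :: s) (p + 1) (false :: s')
  | skip {s p s'} : RowTwoInsert s p s' → RowTwoInsert (true :: s) (p + 1) (true :: s')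

theorem RowOneInsert.excess_eq {s p s'} (h : RowOneInsert s p s') :
    excess s' = excess s + 1 := by
  induction h with
  | here s => simp [excess, stepSign]; ring
  | skip _ ih => simp only [excess, ih]; ring

theorem RowTwoInsert.excess_eq {s p s'} (h : RowTwoInsert s p s') :
    excess s' = excess s - 1 := by
  induction h with
  | bump h => simp [excess, stepSign, h.excess_eq]
  | skip _ ih => simp only [excess, ih]; ring

theorem RowOneInsert.length_eq {s p s'} (h : RowOneInsert s p s') :
    s'.length = s.length + 1 := by
  induction h <;> simp_all

theorem RowTwoInsert.length_eq {s p s'} (h : RowTwoInsert s p s') :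
    s'.length = s.length + 1 := by
  induction h with
  | bump h => simp [h.length_eq]
  | skip _ ih => simp [ih]

theorem RowOneInsert.le_length {s p s'} (h : RowOneInsert s p s') : p ≤ s.length := by
  induction h <;> simp_all

theorem RowTwoInsert.le_length {s p s'} (h : RowTwoInsert s p s') : p ≤ s.length := by
  induction h with
  | bump h => simp [h.le_length]
  | skip _ ih => simp [ih]

theorem RowOneInsert.ballot {s p s'} (h : RowOneInsert s p s') (hs : Ballot s) :
    Ballot s' := by
  induction h with
  | here s => exact ⟨hs, by have := hs.excess_nonneg; simp [excess, stepSign]; omega⟩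
  | skip h ih =>
    refine ⟨ih hs.1, ?_⟩
    have := hs.2
    have := h.excess_eq
    simp_all [excess, stepSign]; omega

theorem RowTwoInsert.ballot {s p s'} (h : RowTwoInsert s p s') (hs : Ballot s) :
    Ballot s' := by
  induction h with
  | bump h =>
    refine ⟨h.ballot hs.1, ?_⟩
    have := hs.1.excess_nonneg
    have := h.excess_eq
    simp_all [excess, stepSign]
  | skip h ih =>
    refine ⟨ih hs.1, ?_⟩
    have := (ih hs.1).excess_nonneg
    simp_all [excess, stepSign]; omega

/-- The inserted entry is the first `true` of the target, so the target alone reveals it. -/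
theorem RowOneInsert.source_unique {s p s' t q} (h : RowOneInsert s p s')
    (h' : RowOneInsert t q s') : s = t ∧ p = q := by
  induction h generalizing t q with
  | here s => cases h'; simp
  | skip h ih =>
    cases h' with
    | skip h' => obtain ⟨rfl, rfl⟩ := ih h'; simp

/-- The first `false` of the target is the bumped entry and the next `true` is the inserted one. -/
theorem RowTwoInsert.source_unique {s p s' t q} (h : RowTwoInsert s p s')
    (h' : RowTwoInsert t q s') : s = t ∧ p = q := by
  induction h generalizing t q with
  | bump h =>
    cases h' with
    | bump h' => obtain ⟨rfl, rfl⟩ := h.source_unique h'; simp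
  | skip h ih =>
    cases h' with
    | skip h' => obtain ⟨rfl, rfl⟩ := ih h'; simp

theorem RowOneInsert.target_unique {s p s' t'} (h : RowOneInsert s p s')
    (h' : RowOneInsert s p t') : s' = t' := by
  induction h generalizing t' with
  | here s => cases h'; rfl
  | skip h ih =>
    cases h' with
    | skip h' => rw [ih h']

/-- Bumping needs a first-row entry among the first `p` letters; appending to the first row needs
that there be none. -/
theorem RowOneInsert.not_rowTwoInsert {s p s' t'} (h : RowOneInsert s p s') :
    ¬ RowTwoInsert s p t' := by
  intro h'
  induction h generalizing t' with
  | here s => cases h'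
  | skip h ih => cases h'

theorem RowTwoInsert.target_unique {s p s' t'} (h : RowTwoInsert s p s')
    (h' : RowTwoInsert s p t') : s' = t' := by
  induction h generalizing t' with
  | bump h =>
    cases h' with
    | bump h' => rw [h.target_unique h']
    | skip h' => exact (h.not_rowTwoInsert h').elim
  | skip h ih =>
    cases h' with
    | bump h' => exact (h'.not_rowTwoInsert h).elim
    | skip h' => rw [ih h']

/-- Reverse insertion starting from the end of the first row. -/
theorem exists_rowOneInsert {w : List Bool} (hw : Ballot w) (h : 0 < excess w) :
    ∃ s p, Ballot s ∧ RowOneInsert s p w := by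
  induction w with
  | nil => simp [excess] at h
  | cons c w ih =>
    cases c with
    | true => exact ⟨w, 0, hw.1, .here w⟩
    | false =>
      obtain ⟨s, p, hs, hi⟩ := ih hw.1 (by simp [excess, stepSign] at h; omega)
      refine ⟨false :: s, p + 1, ⟨hs, ?_⟩, hi.skip⟩
      have := hi.excess_eq
      simp [excess, stepSign] at h ⊢
      omega

/-- Reverse insertion starting from the end of the second row. -/
theorem exists_rowTwoInsert {w : List Bool} (hw : Ballot w) (h : excess w < w.length) :
    ∃ s p, Ballot s ∧ RowTwoInsert s p w := by
  induction w with
  | nil => simp [excess] at h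
  | cons c w ih =>
    cases c with
    | true =>
      obtain ⟨s, p, hs, hi⟩ := ih hw.1 (by simp [excess, stepSign] at h; omega)
      refine ⟨true :: s, p + 1, ⟨hs, ?_⟩, hi.skip⟩
      have := hs.excess_nonneg
      simp [excess, stepSign]
      omega
    | false =>
      have h2 := hw.2
      obtain ⟨s, p, hs, hi⟩ := exists_rowOneInsert hw.1
        (by simp [excess, stepSign] at h2; omega)
      refine ⟨true :: s, p + 1, ⟨hs, ?_⟩, .bump hi⟩
      have := hs.excess_nonneg
      simp [excess, stepSign]
      omega

/-! ### Descents of the word and of the list of openers -/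

/-- All `true`s precede all `false`s. -/
def TruesFirst (w : List Bool) : Prop := w.Pairwise fun x y => y = true → x = true

/-- The entry to bump is the last `true` among the first `p` letters. It fits at the end of the
second row provided no `false` precedes it. -/
theorem exists_insert_of_truesFirst {w : List Bool} {p : ℕ} (hp : p ≤ w.length)
    (h : TruesFirst (w.take p)) : (∃ w', RowOneInsert w p w') ∨ ∃ w', RowTwoInsert w p w' := by
  induction w generalizing p with
  | nil =>
    obtain rfl : p = 0 := by simpa using hp
    exact .inl ⟨_, .here _⟩
  | cons c w ih =>
    cases p with
    | zero => exact .inl ⟨_, .here _⟩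
    | succ p =>
      simp only [TruesFirst, List.take_succ_cons, List.pairwise_cons] at h
      have := ih (by simpa using hp) h.2
      cases c with
      | true =>
        rcases this with ⟨w', h'⟩ | ⟨w', h'⟩
        · exact .inr ⟨_, .bump h'⟩
        · exact .inr ⟨_, .skip h'⟩
      | false =>
        rcases this with ⟨w', h'⟩ | ⟨w', h'⟩
        · exact .inl ⟨_, .skip h'⟩
        · cases h' <;> simp at h

theorem RowOneInsert.truesFirst {s p s'} (h : RowOneInsert s p s') :
    TruesFirst (s.take p) ∧ ∀ x ∈ s.take p, x = false := by
  induction h with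
  | here s => simp [TruesFirst]
  | skip h ih => simp_all [TruesFirst]

theorem RowTwoInsert.truesFirst {s p s'} (h : RowTwoInsert s p s') :
    TruesFirst (s.take p) := by
  induction h with
  | bump h => have := h.truesFirst; simp_all [TruesFirst]
  | skip h ih => simp_all [TruesFirst]

theorem RowOneInsert.forall_mem_take {s p s'} (h : RowOneInsert s p s') (b : ℕ) :
    (∀ x ∈ s'.take b, x = false) ↔ b ≤ p := by
  induction h generalizing b with
  | here s => cases b <;> simp
  | skip h ih => cases b <;> simp_all

/-- For `p > 0` the new `true` at position `p` follows a `false`. For `p = 0` it comes first and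
spoils no window. -/
theorem RowOneInsert.truesFirst_target {s p s'} (h : RowOneInsert s p s') (b : ℕ)
    (hp : 0 < p) : TruesFirst (s'.take b) ↔ b ≤ p := by
  cases h with
  | here s => simp at hp
  | @skip s p s' h =>
    cases b with
    | zero => simp [TruesFirst]
    | succ b =>
      have h1 := h.forall_mem_take b
      simp only [TruesFirst, List.take_succ_cons, List.pairwise_cons, add_le_add_iff_right,
        ← h1]
      refine ⟨fun h2 x hx => by simpa using h2.1 x hx, fun h2 => ⟨fun x hx => by simp [h2 x hx],
        List.pairwise_of_forall_mem_list fun x hx y hy => by simp [h2 y hy]⟩⟩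

theorem RowTwoInsert.truesFirst_target {s p s'} (h : RowTwoInsert s p s') (b : ℕ) :
    TruesFirst (s'.take b) ↔ b ≤ p := by
  induction h generalizing b with
  | @bump s p s' h => exact (RowOneInsert.skip h).truesFirst_target b p.succ_pos
  | skip h ih =>
    cases b with
    | zero => simp [TruesFirst]
    | succ b =>
      simp only [TruesFirst, List.take_succ_cons, List.pairwise_cons, add_le_add_iff_right,
        implies_true, true_and]
      exact ih b

/-- In all windows, `w` has its `true`s first exactly if `L` is decreasing. -/
def SameProfile : List ℕ → List Bool → Prop
  | [], [] => True
  | x :: L, c :: w => SameProfile L w ∧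
      ∀ b, ((x :: L).take b).Pairwise (· > ·) ↔ TruesFirst ((c :: w).take b)
  | _, _ => False

theorem SameProfile.length_eq : ∀ {L : List ℕ} {w : List Bool}, SameProfile L w →
    L.length = w.length
  | [], [], _ => rfl
  | _ :: _, _ :: _, h => by simp [h.1.length_eq]
  | [], _ :: _, h => h.elim
  | _ :: _, [], h => h.elim

theorem SameProfile.take_iff {L : List ℕ} {w : List Bool} (h : SameProfile L w) (b : ℕ) :
    (L.take b).Pairwise (· > ·) ↔ TruesFirst (w.take b) := by
  match L, w, h with
  | [], [], _ => simp [TruesFirst]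
  | _ :: _, _ :: _, h => exact h.2 b

/-- The head of `L` stays in front of `N` and is smaller, so a window is spoiled exactly when it
reaches `N`. The word behaves in the same way under insertion. -/
theorem pairwise_gt_take_insertIdx {L : List ℕ} {p N : ℕ} (hN : ∀ x ∈ L, x < N)
    (hp : p ≤ L.length) (h0 : 0 < p) (hL : (L.take p).Pairwise (· > ·)) (b : ℕ) :
    ((L.insertIdx p N).take b).Pairwise (· > ·) ↔ b ≤ p := by
  constructor
  · intro h
    by_contra! hb
    rw [List.pairwise_iff_getElem] at h
    have hl := List.length_insertIdx_of_le_length hp N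
    have := h 0 p (by simp; omega) (by simp; omega) h0
    rw [List.getElem_take, List.getElem_take, List.getElem_insertIdx_self,
      List.getElem_insertIdx_of_lt h0] at this
    have := hN _ (List.getElem_mem (l := L) (n := 0) (by omega))
    omega
  · intro hb
    have : (L.insertIdx p N).take b = L.take b := by
      apply List.ext_getElem
      · simp [List.length_insertIdx_of_le_length hp]; omega
      · intro i h1 h2
        simp at h1
        rw [List.getElem_take, List.getElem_take, List.getElem_insertIdx_of_lt (by omega)]
    rw [this, ← min_eq_left hb, ← List.take_take]
    exact hL.sublist (List.take_sublist _ _)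

theorem SameProfile.cons_top {L : List ℕ} {w : List Bool} {N : ℕ} (h : SameProfile L w)
    (hN : ∀ x ∈ L, x < N) : SameProfile (N :: L) (true :: w) := by
  refine ⟨h, fun b => ?_⟩
  cases b with
  | zero => simp [TruesFirst]
  | succ b =>
    have := h.take_iff b
    simp only [TruesFirst, List.take_succ_cons, List.pairwise_cons, implies_true, true_and]
      at this ⊢
    rw [← this]
    exact ⟨fun h => h.2, fun h => ⟨fun x hx => hN x (List.mem_of_mem_take hx), h⟩⟩

theorem SameProfile.rowOneInsert {L : List ℕ} {w w' : List Bool} {p N : ℕ}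
    (hi : RowOneInsert w p w') (h : SameProfile L w) (hN : ∀ x ∈ L, x < N) :
    SameProfile (L.insertIdx p N) w' := by
  induction hi generalizing L with
  | here s => exact h.cons_top hN
  | @skip s p s' hi ih =>
    have hlen := h.length_eq
    have hi' := RowOneInsert.skip hi
    have hle := hi.le_length
    match L, h with
    | x :: L, h =>
      have ht := (h.take_iff (p + 1)).2 hi'.truesFirst.1
      simp only [List.insertIdx_succ_cons]
      refine ⟨ih h.1 fun y hy => hN y (by simp [hy]), fun b => ?_⟩
      rw [← List.insertIdx_succ_cons, hi'.truesFirst_target b (by omega)]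
      exact pairwise_gt_take_insertIdx hN (by simp at hlen ⊢; omega) (by omega) ht b

theorem SameProfile.rowTwoInsert {L : List ℕ} {w w' : List Bool} {p N : ℕ}
    (hi : RowTwoInsert w p w') (h : SameProfile L w) (hN : ∀ x ∈ L, x < N) :
    SameProfile (L.insertIdx p N) w' := by
  -- Bumping and skipping differ only in how the tails correspond; the windows starting at the head
  -- are treated alike.
  have key : ∀ {s p s' c c'} {L : List ℕ}, RowTwoInsert (c :: s) (p + 1) (c' :: s') →
      SameProfile L (c :: s) → (∀ x ∈ L, x < N) →
      (∀ {L : List ℕ}, SameProfile L s → (∀ x ∈ L, x < N) →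
        SameProfile (L.insertIdx p N) s') →
      SameProfile (L.insertIdx (p + 1) N) (c' :: s') := by
    intro s p s' c c' L hi h hN ih
    have hlen := h.length_eq
    have hle := hi.le_length
    match L, h with
    | x :: L, h =>
      have ht := (h.take_iff (p + 1)).2 hi.truesFirst
      simp only [List.insertIdx_succ_cons]
      refine ⟨ih h.1 fun y hy => hN y (by simp [hy]), fun b => ?_⟩
      rw [← List.insertIdx_succ_cons, hi.truesFirst_target b]
      exact pairwise_gt_take_insertIdx hN (by omega) (by omega) ht b
  induction hi generalizing L with
  | bump hi => exact key (.bump hi) h hN fun h' hN' => h'.rowOneInsert hi hN'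
  | skip hi ih => exact key (.skip hi) h hN fun h' hN' => ih h' hN'

/-! ### Partial matchings: opening and closing a block -/

theorem insertIdx_length_append (L₁ L₂ : List ℕ) (x : ℕ) :
    (L₁ ++ L₂).insertIdx L₁.length x = L₁ ++ x :: L₂ := by
  induction L₁ with
  | nil => simp
  | cons y L₁ ih => simp [ih]

/-- `A` is the set of closed blocks and `L` the list of pending openers, in the order in which they
will be closed, of a matching read up to position `n`. -/
structure PartialMatching (n : ℕ) (A : Finset (Finset ℕ)) (L : List ℕ) : Prop where
  card : ∀ B ∈ A, B.card = 2
  disjoint : ∀ B ∈ A, ∀ C ∈ A, ∀ x, x ∈ B → x ∈ C → B = C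
  mem_iff : ∀ x, (x ∈ L ∨ ∃ B ∈ A, x ∈ B) ↔ 1 ≤ x ∧ x ≤ n
  nodup : L.Nodup
  notMem : ∀ x ∈ L, ∀ B ∈ A, x ∉ B

namespace PartialMatching

variable {n : ℕ} {A : Finset (Finset ℕ)} {L : List ℕ}

theorem le_of_mem (h : PartialMatching n A L) {x : ℕ} (hx : x ∈ L) : x ≤ n :=
  ((h.mem_iff x).1 (.inl hx)).2

theorem le_of_mem_block (h : PartialMatching n A L) {B : Finset ℕ} (hB : B ∈ A) {x : ℕ}
    (hx : x ∈ B) : x ≤ n :=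
  ((h.mem_iff x).1 (.inr ⟨B, hB, hx⟩)).2

theorem close {i : ℕ} (h : PartialMatching n A (i :: L)) :
    PartialMatching (n + 1) (insert {i, n + 1} A) L where
  card B hB := by
    rcases Finset.mem_insert.1 hB with rfl | hB
    · have := h.le_of_mem (x := i) (by simp)
      exact Finset.card_pair (by omega)
    · exact h.card B hB
  disjoint := by
    have key : ∀ B ∈ A, ∀ x, x ∈ ({i, n + 1} : Finset ℕ) → x ∉ B := by
      intro B hB x hx hxB
      rcases Finset.mem_insert.1 hx with rfl | hx
      · exact h.notMem x (by simp) B hB hxB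
      · have := h.le_of_mem_block hB hxB
        simp at hx
        omega
    intro B hB C hC x hxB hxC
    rcases Finset.mem_insert.1 hB with rfl | hB <;> rcases Finset.mem_insert.1 hC with rfl | hC
    · rfl
    · exact (key C hC x hxB hxC).elim
    · exact (key B hB x hxC hxB).elim
    · exact h.disjoint B hB C hC x hxB hxC
  mem_iff x := by
    have h1 := h.mem_iff x
    have h2 := (h.mem_iff i).1 (by simp)
    simp only [Finset.mem_insert, or_and_right, exists_or, exists_eq_left,
      Finset.mem_singleton, List.mem_cons] at h1 ⊢
    by_cases hx : x = n + 1
    · subst hx; simp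
    · by_cases hxi : x = i
      · subst hxi; simp; omega
      · simp only [hx, hxi, false_or, or_false] at h1 ⊢
        rw [h1]
        omega
  nodup := (List.nodup_cons.1 h.nodup).2
  notMem x hx B hB := by
    rcases Finset.mem_insert.1 hB with rfl | hB
    · have := h.le_of_mem (x := x) (by simp [hx])
      have := (List.nodup_cons.1 h.nodup).1
      simp only [Finset.mem_insert, Finset.mem_singleton]
      rintro (rfl | rfl)
      · exact this hx
      · omega
    · exact h.notMem x (by simp [hx]) B hB

theorem exists_close (h : PartialMatching (n + 1) A L) {B : Finset ℕ} (hB : B ∈ A)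
    (hn : n + 1 ∈ B) :
    ∃ i A', A = insert {i, n + 1} A' ∧ PartialMatching n A' (i :: L) := by
  obtain ⟨i, hi, rfl⟩ : ∃ i, i ≠ n + 1 ∧ B = {i, n + 1} := by
    obtain ⟨x, y, hxy, rfl⟩ := Finset.card_eq_two.1 (h.card B hB)
    rcases Finset.mem_insert.1 hn with rfl | hn
    · exact ⟨y, hxy.symm, Finset.pair_comm _ _⟩
    · rw [Finset.mem_singleton] at hn
      subst hn
      exact ⟨x, hxy, rfl⟩
  refine ⟨i, A.erase {i, n + 1}, (Finset.insert_erase hB).symm, ?_, ?_, ?_, ?_, ?_⟩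
  · exact fun C hC => h.card C (Finset.mem_of_mem_erase hC)
  · exact fun C hC D hD =>
      h.disjoint C (Finset.mem_of_mem_erase hC) D (Finset.mem_of_mem_erase hD)
  · intro x
    have h1 := h.mem_iff x
    by_cases hx : x = n + 1
    · subst hx
      simp only [List.mem_cons]
      refine iff_of_false ?_ (by omega)
      rintro ((h2 | h2) | ⟨C, hC, h2⟩)
      · exact hi h2.symm
      · exact h.notMem _ h2 _ hB hn
      · exact Finset.ne_of_mem_erase hC (h.disjoint _ (Finset.mem_of_mem_erase hC) _ hB _ h2 hn)
    · have h3 : 1 ≤ x ∧ x ≤ n ↔ 1 ≤ x ∧ x ≤ n + 1 := by omega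
      rw [h3, ← h1, List.mem_cons]
      constructor
      · rintro ((rfl | h2) | ⟨C, hC, h2⟩)
        · exact .inr ⟨_, hB, by simp⟩
        · exact .inl h2
        · exact .inr ⟨C, Finset.mem_of_mem_erase hC, h2⟩
      · rintro (h2 | ⟨C, hC, h2⟩)
        · exact .inl (.inr h2)
        · by_cases hCB : C = {i, n + 1}
          · subst hCB
            simp [hx] at h2
            exact .inl (.inl h2)
          · exact .inr ⟨C, Finset.mem_erase.2 ⟨hCB, hC⟩, h2⟩
  · exact List.nodup_cons.2 ⟨fun h2 => h.notMem _ h2 _ hB (by simp), h.nodup⟩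
  · intro x hx C hC hxC
    rcases List.mem_cons.1 hx with rfl | hx
    · exact Finset.ne_of_mem_erase hC
        (h.disjoint _ (Finset.mem_of_mem_erase hC) _ hB _ hxC (by simp))
    · exact h.notMem x hx C (Finset.mem_of_mem_erase hC) hxC

theorem open_at (h : PartialMatching n A L) {p : ℕ} (hp : p ≤ L.length) :
    PartialMatching (n + 1) A (L.insertIdx p (n + 1)) where
  card := h.card
  disjoint := h.disjoint
  mem_iff x := by
    have := h.mem_iff x
    rw [List.mem_insertIdx hp, or_assoc, this]
    omega
  nodup := by
    rw [(List.perm_insertIdx _ _ hp).nodup_iff, List.nodup_cons]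
    exact ⟨fun hx => by have := h.le_of_mem hx; omega, h.nodup⟩
  notMem x hx B hB hxB := by
    rcases (List.mem_insertIdx hp).1 hx with rfl | hx
    · have := h.le_of_mem_block hB hxB
      omega
    · exact h.notMem x hx B hB hxB

theorem exists_open (h : PartialMatching (n + 1) A L) (hn : n + 1 ∈ L) :
    ∃ p L', p ≤ L'.length ∧ L = L'.insertIdx p (n + 1) ∧ PartialMatching n A L' := by
  obtain ⟨L₁, L₂, rfl⟩ := List.append_of_mem hn
  have hnd := List.perm_middle.nodup_iff.1 h.nodup
  rw [List.nodup_cons] at hnd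
  have hmem : ∀ x, x ∈ L₁ ++ (n + 1) :: L₂ ↔ x = n + 1 ∨ x ∈ L₁ ++ L₂ := fun x => by
    rw [List.perm_middle.mem_iff, List.mem_cons]
  refine ⟨L₁.length, L₁ ++ L₂, by simp, (insertIdx_length_append L₁ L₂ _).symm, h.card,
    h.disjoint, fun x => ?_, hnd.2, fun x hx => h.notMem x ((hmem x).2 (.inr hx))⟩
  have h1 := h.mem_iff x
  rw [hmem] at h1
  by_cases hx : x = n + 1
  · subst hx
    refine iff_of_false ?_ (by omega)
    rintro (h2 | ⟨B, hB, h2⟩)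
    · exact hnd.1 h2
    · exact h.notMem _ hn B hB h2
  · simp only [hx, false_or] at h1
    rw [h1]
    omega

end PartialMatching

/-! ### Crossings of completed partial matchings -/

/-- The arcs of a partial matching up to `n` in which the pending openers `L` are joined to
`n + 1, n + 2, …` in order. -/
def CompletedArc (n : ℕ) (A : Finset (Finset ℕ)) (L : List ℕ) (i j : ℕ) : Prop :=
  (i < j ∧ ({i, j} : Finset ℕ) ∈ A) ∨ ∃ e, L[e]? = some i ∧ j = n + 1 + e

/-- A `k`-crossing among the completed arcs of a partial matching. -/
def CompletedCrossing (k n : ℕ) (A : Finset (Finset ℕ)) (L : List ℕ) : Prop :=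
  ∃ i j : Fin k → ℕ, (∀ r, CompletedArc n A L (i r) (j r)) ∧
    StrictMono i ∧ (∀ r s, i r < j s) ∧ StrictMono j

/-- An increasing subsequence of length `k` among the first `p` entries of `L`. -/
def HasIncreasing (k p : ℕ) (L : List ℕ) : Prop :=
  ∃ i e : Fin k → ℕ, (∀ r, e r < p ∧ L[e r]? = some (i r)) ∧ StrictMono i ∧ StrictMono e

section Crossing

variable {k n : ℕ} {A : Finset (Finset ℕ)} {L : List ℕ}

/-- Completion had already joined the first pending opener to `n + 1`, so closing it changes no arc.
-/
theorem completedArc_close {i : ℕ} (hi : i ≤ n) (x y : ℕ) :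
    CompletedArc (n + 1) (insert {i, n + 1} A) L x y ↔ CompletedArc n A (i :: L) x y := by
  unfold CompletedArc
  constructor
  · rintro (⟨hxy, h⟩ | ⟨e, he, rfl⟩)
    · rcases Finset.mem_insert.1 h with h | h
      · have h1 : x ∈ ({i, n + 1} : Finset ℕ) := h ▸ by simp
        have h2 : y ∈ ({i, n + 1} : Finset ℕ) := h ▸ by simp
        simp only [Finset.mem_insert, Finset.mem_singleton] at h1 h2
        obtain rfl : x = i := by omega
        obtain rfl : y = n + 1 := by omega
        exact .inr ⟨0, by simp⟩
      · exact .inl ⟨hxy, h⟩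
    · exact .inr ⟨e + 1, by simpa using he, by omega⟩
  · rintro (⟨hxy, h⟩ | ⟨e, he, rfl⟩)
    · exact .inl ⟨hxy, Finset.mem_insert_of_mem h⟩
    · cases e with
      | zero =>
        obtain rfl : i = x := by simpa using he
        exact .inl ⟨by omega, by simp⟩
      | succ e => exact .inr ⟨e, by simpa using he, by omega⟩

theorem completedCrossing_close {i : ℕ} (hi : i ≤ n) :
    CompletedCrossing k (n + 1) (insert {i, n + 1} A) L ↔ CompletedCrossing k n A (i :: L) := by
  simp only [CompletedCrossing, completedArc_close hi]

/-- The relabelling of positions after `n` that frees position `n + 1` for an opener and position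
`n + 2 + p` for its closer. -/
def openShift (n p j : ℕ) : ℕ :=
  if j ≤ n then j else if j < n + 1 + p then j + 1 else j + 2

theorem openShift_strictMono (n p : ℕ) : StrictMono (openShift n p) := by
  intro x y h
  unfold openShift
  split_ifs <;> omega

theorem le_openShift (n p j : ℕ) : j ≤ openShift n p j := by
  unfold openShift
  split_ifs <;> omega

theorem PartialMatching.completedArc_le (h : PartialMatching n A L) {x y : ℕ}
    (hx : CompletedArc n A L x y) : x ≤ n ∧ x < y := by
  rcases hx with ⟨hxy, hB⟩ | ⟨e, he, rfl⟩
  · exact ⟨h.le_of_mem_block hB (by simp), hxy⟩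
  · have := h.le_of_mem (List.mem_of_getElem? he)
    omega

theorem CompletedArc.open_at {x y p : ℕ} (hA : ∀ B ∈ A, ∀ z ∈ B, z ≤ n)
    (hx : CompletedArc n A L x y) :
    CompletedArc (n + 1) A (L.insertIdx p (n + 1)) x (openShift n p y) := by
  rcases hx with ⟨hxy, hB⟩ | ⟨e, he, rfl⟩
  · have := hA _ hB y (by simp)
    refine .inl ⟨hxy.trans_le (le_openShift _ _ _), ?_⟩
    simpa [openShift, this] using hB
  · by_cases hep : e < p
    · refine .inr ⟨e, by rwa [List.getElem?_insertIdx_of_lt hep], ?_⟩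
      simp only [openShift]
      split_ifs <;> omega
    · refine .inr ⟨e + 1, by rwa [List.getElem?_insertIdx_of_gt (by omega)], ?_⟩
      simp only [openShift]
      split_ifs <;> omega

theorem CompletedArc.of_open_at {x y p : ℕ} (hp : p ≤ L.length) (hA : ∀ B ∈ A, ∀ z ∈ B, z ≤ n)
    (hx : CompletedArc (n + 1) A (L.insertIdx p (n + 1)) x y) :
    (x = n + 1 ∧ y = n + 2 + p) ∨ ∃ y', y = openShift n p y' ∧ CompletedArc n A L x y' := by
  rcases hx with ⟨hxy, hB⟩ | ⟨e, he, rfl⟩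
  · have := hA _ hB y (by simp)
    exact .inr ⟨y, by simp [openShift, this], .inl ⟨hxy, hB⟩⟩
  · rcases lt_trichotomy e p with hep | rfl | hep
    · rw [List.getElem?_insertIdx_of_lt hep] at he
      refine .inr ⟨n + 1 + e, ?_, .inr ⟨e, he, rfl⟩⟩
      simp only [openShift]
      split_ifs <;> omega
    · rw [List.getElem?_insertIdx_self, if_pos (by omega)] at he
      exact .inl ⟨by simpa using he.symm, by omega⟩
    · rw [List.getElem?_insertIdx_of_gt hep] at he
      refine .inr ⟨n + 1 + (e - 1), ?_, .inr ⟨e - 1, he, rfl⟩⟩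
      simp only [openShift]
      split_ifs <;> omega

/-- The opener `n + 1` exceeds all others, so in a crossing its arc is the last one. The remaining
arcs must then close after `n + 1` and before the new closer: they are pending, of index below `p`,
and increasing. Crossings that avoid the new arc are only relabelled by `openShift`. -/
theorem completedCrossing_open (h : PartialMatching n A L) {p : ℕ} (hp : p ≤ L.length) :
    CompletedCrossing (k + 1) (n + 1) A (L.insertIdx p (n + 1)) ↔
      CompletedCrossing (k + 1) n A L ∨ HasIncreasing k p L := by
  have hA : ∀ B ∈ A, ∀ z ∈ B, z ≤ n := fun B hB z hz => h.le_of_mem_block hB hz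
  constructor
  · rintro ⟨i, j, hij, hi, hlt, hj⟩
    by_cases hlast : i (Fin.last k) = n + 1
    · right
      have hjl : j (Fin.last k) = n + 2 + p := by
        rcases (hij (Fin.last k)).of_open_at hp hA with h1 | ⟨y, -, h1⟩
        · exact h1.2
        · have := (h.completedArc_le h1).1
          omega
      have key : ∀ r : Fin k, ∃ e, (e < p ∧ L[e]? = some (i r.castSucc)) ∧
          j r.castSucc = n + 2 + e := by
        intro r
        have h1 := hlt (Fin.last k) r.castSucc
        have h2 := hj (Fin.castSucc_lt_last r)
        have h3 := hi (Fin.castSucc_lt_last r)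
        rcases hij r.castSucc with ⟨-, hB⟩ | ⟨e, he, hje⟩
        -- A closed block ends at or before `n`, hence before the new opener.
        · have := hA _ hB (j r.castSucc) (by simp)
          omega
        · rw [List.getElem?_insertIdx_of_lt (by omega)] at he
          exact ⟨e, ⟨by omega, he⟩, by omega⟩
      choose e he hje using key
      refine ⟨fun r => i r.castSucc, e, he, hi.comp (Fin.strictMono_castSucc), fun r s hrs => ?_⟩
      have := hj (Fin.castSucc_lt_castSucc_iff.2 hrs)
      have := hje r
      have := hje s
      omega
    · left
      have hne : ∀ r, i r ≠ n + 1 := by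
        intro r hr
        have h1 := hi.monotone (Fin.le_last r)
        rcases (hij (Fin.last k)).of_open_at hp hA with h2 | ⟨y, -, h2⟩
        · exact hlast h2.1
        · have := (h.completedArc_le h2).1
          omega
      have key : ∀ r, ∃ y, j r = openShift n p y ∧ CompletedArc n A L (i r) y := fun r =>
        ((hij r).of_open_at hp hA).resolve_left fun h1 => hne r h1.1
      choose y hy hiy using key
      refine ⟨i, y, hiy, hi, fun r s => ?_, fun r s hrs => ?_⟩
      -- If `y s ≤ i r ≤ n`, the shift would fix `y s` and the inequality would already fail after
      -- opening.
      · by_contra! hc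
        have h1 := (h.completedArc_le (hiy r)).1
        have h2 := hlt r s
        rw [hy, openShift, if_pos (by omega)] at h2
        omega
      · have := hj hrs
        rw [hy, hy] at this
        exact (openShift_strictMono n p).lt_iff_lt.1 this
  · rintro (⟨i, j, hij, hi, hlt, hj⟩ | ⟨i, e, hie, hi, he⟩)
    · exact ⟨i, fun r => openShift n p (j r), fun r => (hij r).open_at hA, hi,
        fun r s => (hlt r s).trans_le (le_openShift _ _ _), (openShift_strictMono n p).comp hj⟩
    · have hin : ∀ r, i r ≤ n := fun r => h.le_of_mem (List.mem_of_getElem? (hie r).2)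
      -- The new arc is put last. The other closers lie before index `p`, so they all move up by
      -- exactly one.
      refine ⟨Fin.snoc (α := fun _ => ℕ) i (n + 1),
        Fin.snoc (α := fun _ => ℕ) (fun r => n + 2 + e r) (n + 2 + p), ?_, ?_, ?_, ?_⟩
      · intro r
        induction r using Fin.lastCases with
        | last =>
          simp only [Fin.snoc_last]
          exact .inr ⟨p, by rw [List.getElem?_insertIdx_self, if_pos (by omega)], by omega⟩
        | cast r =>
          simp only [Fin.snoc_castSucc]
          exact .inr ⟨e r, by rw [List.getElem?_insertIdx_of_lt (hie r).1]; exact (hie r).2,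
            by omega⟩
      · intro r s hrs
        induction s using Fin.lastCases with
        | last =>
          induction r using Fin.lastCases with
          | last => simp at hrs
          | cast r => simp only [Fin.snoc_last, Fin.snoc_castSucc]; have := hin r; omega
        | cast s =>
          induction r using Fin.lastCases with
          | last => exact ((Fin.le_last _).not_gt hrs).elim
          | cast r =>
            simp only [Fin.snoc_castSucc]
            exact hi (Fin.castSucc_lt_castSucc_iff.1 hrs)
      · intro r s
        have h1 : Fin.snoc (α := fun _ => ℕ) i (n + 1) r ≤ n + 1 := by
          induction r using Fin.lastCases with
          | last => simp
          | cast r => simp only [Fin.snoc_castSucc]; have := hin r; omega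
        have h2 : n + 2 ≤ Fin.snoc (α := fun _ => ℕ) (fun r => n + 2 + e r) (n + 2 + p) s := by
          induction s using Fin.lastCases with
          | last => simp
          | cast r => simp
        omega
      · intro r s hrs
        induction s using Fin.lastCases with
        | last =>
          induction r using Fin.lastCases with
          | last => simp at hrs
          | cast r => simp only [Fin.snoc_last, Fin.snoc_castSucc]; have := (hie r).1; omega
        | cast s =>
          induction r using Fin.lastCases with
          | last => exact ((Fin.le_last _).not_gt hrs).elim
          | cast r =>
            simp only [Fin.snoc_castSucc]
            have := he (Fin.castSucc_lt_castSucc_iff.1 hrs)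
            omega

theorem hasIncreasing_one {p : ℕ} (hp : p ≤ L.length) : HasIncreasing 1 p L ↔ 0 < p := by
  constructor
  · rintro ⟨i, e, h, -⟩
    have := (h 0).1
    omega
  · intro h
    exact ⟨fun _ => L[0], fun _ => 0, fun _ => ⟨h, by simp⟩, Subsingleton.strictMono _,
      Subsingleton.strictMono _⟩

theorem hasIncreasing_two {p : ℕ} (hL : L.Nodup) :
    HasIncreasing 2 p L ↔ ¬ (L.take p).Pairwise (· > ·) := by
  rw [List.pairwise_iff_getElem]
  push Not
  constructor
  · rintro ⟨i, e, h, hi, he⟩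
    have h0 := h 0
    have h1 := h 1
    obtain ⟨hl0, h0'⟩ := List.getElem?_eq_some_iff.1 h0.2
    obtain ⟨hl1, h1'⟩ := List.getElem?_eq_some_iff.1 h1.2
    refine ⟨e 0, e 1, by simp; omega, by simp; omega, he (by decide), ?_⟩
    rw [List.getElem_take, List.getElem_take, h0', h1']
    exact (hi (by decide)).le
  · rintro ⟨a, b, ha, hb, hab, hlt⟩
    rw [List.getElem_take, List.getElem_take] at hlt
    simp only [List.length_take, lt_inf_iff] at ha hb
    refine ⟨![L[a], L[b]], ![a, b], ?_, ?_, ?_⟩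
    · simp [Fin.forall_fin_two, ha, hb]
    · have : L[a] ≠ L[b] := fun h => hab.ne ((hL.getElem_inj_iff).1 h)
      intro r s hrs
      fin_cases r <;> fin_cases s <;> simp_all
      omega
    · intro r s hrs
      fin_cases r <;> fin_cases s <;> simp_all

end Crossing

/-! ### Runs: matchings, tableaux and histories of shapes -/

/-- A history of steps, most recent first, of a pair of lattice paths of which the first never goes
below the second and the second never goes below the axis. -/
def NoncrossingHistory : List (Bool × Bool) → Prop
  | [] => True
  | s :: h => NoncrossingHistory h ∧ 0 ≤ excess ((s :: h).map Prod.snd) ∧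
      excess ((s :: h).map Prod.snd) ≤ excess ((s :: h).map Prod.fst)

/-- `TableauRun n A L w h`: reading a matching up to position `n`, with closed blocks `A` and
pending openers `L`, yields the tableau `w`, and `h` is the history of its shape. A shape with
rows `a ≥ b` is recorded by the heights `a + b` and `a - b`. -/
inductive TableauRun : ℕ → Finset (Finset ℕ) → List ℕ → List Bool → List (Bool × Bool) → Prop
  | nil : TableauRun 0 ∅ [] [] []
  | openOne {n A L w h p w'} : TableauRun n A L w h → RowOneInsert w p w' →
      TableauRun (n + 1) A (L.insertIdx p (n + 1)) w' ((true, true) :: h)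
  | openTwo {n A L w h p w'} : TableauRun n A L w h → RowTwoInsert w p w' →
      TableauRun (n + 1) A (L.insertIdx p (n + 1)) w' ((true, false) :: h)
  | close {n A i L c w h} : TableauRun n A (i :: L) (c :: w) h →
      TableauRun (n + 1) (insert {i, n + 1} A) L w ((false, !c) :: h)

theorem excess_le_length (w : List Bool) : excess w ≤ w.length := by
  induction w with
  | nil => simp [excess]
  | cons c w ih => cases c <;> simp [excess, stepSign] <;> omega

theorem RowOneInsert.false_mem {s p s'} (h : RowOneInsert s p s') (hp : 0 < p) : false ∈ s := by
  cases h <;> simp_all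

theorem RowOneInsert.false_mem_of_target {s p s'} (h : RowOneInsert s p s') (h' : false ∈ s') :
    false ∈ s := by
  cases h <;> simp_all

theorem RowTwoInsert.pos {s p s'} (h : RowTwoInsert s p s') : 0 < p := by
  cases h <;> omega

theorem not_completedCrossing_zero {k : ℕ} : ¬ CompletedCrossing (k + 1) 0 ∅ [] := by
  rintro ⟨i, j, h, -⟩
  simpa [CompletedArc] using h 0

theorem partialMatching_zero : PartialMatching 0 ∅ [] where
  card := by simp
  disjoint := by simp
  mem_iff x := by simp; omega
  nodup := by simp
  notMem := by simp

namespace TableauRun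

variable {n : ℕ} {A : Finset (Finset ℕ)} {L : List ℕ} {w : List Bool} {h : List (Bool × Bool)}

/-- The two are proved together: the profile gives the lengths that make the insertion index legal,
and the matching gives that `n + 1` exceeds all pending openers. -/
theorem partialMatching_and_sameProfile (H : TableauRun n A L w h) :
    PartialMatching n A L ∧ SameProfile L w := by
  induction H with
  | nil => exact ⟨partialMatching_zero, trivial⟩
  | openOne _ hi ih =>
    exact ⟨ih.1.open_at (ih.2.length_eq ▸ hi.le_length),
      ih.2.rowOneInsert hi fun x hx => Nat.lt_succ_of_le (ih.1.le_of_mem hx)⟩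
  | openTwo _ hi ih =>
    exact ⟨ih.1.open_at (ih.2.length_eq ▸ hi.le_length),
      ih.2.rowTwoInsert hi fun x hx => Nat.lt_succ_of_le (ih.1.le_of_mem hx)⟩
  | close _ ih => exact ⟨ih.1.close, ih.2.1⟩

theorem partialMatching (H : TableauRun n A L w h) : PartialMatching n A L :=
  H.partialMatching_and_sameProfile.1

theorem sameProfile (H : TableauRun n A L w h) : SameProfile L w :=
  H.partialMatching_and_sameProfile.2

theorem length_history (H : TableauRun n A L w h) : h.length = n := by
  induction H <;> simp_all

theorem ballot (H : TableauRun n A L w h) : Ballot w := by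
  induction H with
  | nil => trivial
  | openOne _ hi ih => exact hi.ballot ih
  | openTwo _ hi ih => exact hi.ballot ih
  | close _ ih => exact ih.1

theorem heights (H : TableauRun n A L w h) :
    excess (h.map Prod.fst) = w.length ∧ excess (h.map Prod.snd) = excess w := by
  induction H with
  | nil => simp [excess]
  | openOne _ hi ih =>
    simp [excess, stepSign, ih, hi.length_eq, hi.excess_eq, add_comm]
  | openTwo _ hi ih =>
    simp [excess, stepSign, ih, hi.length_eq, hi.excess_eq]
    omega
  | @close n A i L c w h _ ih =>
    cases c <;> simp [excess, stepSign, ih]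

theorem noncrossingHistory (H : TableauRun n A L w h) : NoncrossingHistory h := by
  have key : ∀ {n A L w s h}, TableauRun n A L w (s :: h) → NoncrossingHistory h →
      NoncrossingHistory (s :: h) := fun H' hh => by
    refine ⟨hh, ?_, ?_⟩ <;> rw [H'.heights.2]
    · exact H'.ballot.excess_nonneg
    · exact H'.heights.1 ▸ excess_le_length _
  induction H with
  | nil => trivial
  | openOne H' hi ih => exact key (H'.openOne hi) ih
  | openTwo H' hi ih => exact key (H'.openTwo hi) ih
  | close H' ih => exact key H'.close ih

theorem not_completedCrossing_three (H : TableauRun n A L w h) :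
    ¬ CompletedCrossing 3 n A L := by
  have key : ∀ {n A L w h p}, TableauRun n A L w h → ¬ CompletedCrossing 3 n A L →
      p ≤ w.length → TruesFirst (w.take p) →
      ¬ CompletedCrossing 3 (n + 1) A (L.insertIdx p (n + 1)) := fun H' hc hp ht => by
    rw [completedCrossing_open H'.partialMatching (H'.sameProfile.length_eq ▸ hp),
      hasIncreasing_two H'.partialMatching.nodup, H'.sameProfile.take_iff]
    simp [hc, ht]
  induction H with
  | nil => exact not_completedCrossing_zero
  | openOne H' hi ih => exact key H' ih hi.le_length hi.truesFirst.1
  | openTwo H' hi ih => exact key H' ih hi.le_length hi.truesFirst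
  | close H' ih => rwa [completedCrossing_close (H'.partialMatching.le_of_mem (by simp))]

/-- The second conjunct serves the induction: a first-row insertion at `p > 0` passes a second-row
entry, which must stem from an earlier step where the two paths differ. -/
theorem completedCrossing_two_and (H : TableauRun n A L w h) :
    (CompletedCrossing 2 n A L ↔ ∃ s ∈ h, s.1 ≠ s.2) ∧ (false ∈ w → ∃ s ∈ h, s.1 ≠ s.2) := by
  induction H with
  | nil => simp [not_completedCrossing_zero]
  | openOne H' hi ih =>
    have hp := H'.sameProfile.length_eq ▸ hi.le_length
    rw [completedCrossing_open H'.partialMatching hp, hasIncreasing_one hp, ih.1]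
    refine ⟨⟨?_, fun hs => ?_⟩, fun hf => ?_⟩
    · rintro (⟨s, hs⟩ | hp)
      · exact ⟨s, by simp [hs.1], hs.2⟩
      · obtain ⟨s, hs⟩ := ih.2 (hi.false_mem hp)
        exact ⟨s, by simp [hs.1], hs.2⟩
    · exact .inl (by simpa using hs)
    · obtain ⟨s, hs⟩ := ih.2 (hi.false_mem_of_target hf)
      exact ⟨s, by simp [hs.1], hs.2⟩
  | openTwo H' hi ih =>
    have hp := H'.sameProfile.length_eq ▸ hi.le_length
    rw [completedCrossing_open H'.partialMatching hp, hasIncreasing_one hp]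
    simp [hi.pos]
  | @close n A i L c w h H' ih =>
    rw [completedCrossing_close (H'.partialMatching.le_of_mem (by simp)), ih.1]
    cases c with
    | true =>
      simp only [List.exists_mem_cons_iff]
      refine ⟨by simp, fun hf => .inr (ih.2 (by simp [hf]))⟩
    | false =>
      have := ih.2 (by simp)
      simp [-Prod.exists, this]

theorem completedCrossing_two (H : TableauRun n A L w h) :
    CompletedCrossing 2 n A L ↔ ∃ s ∈ h, s.1 ≠ s.2 :=
  H.completedCrossing_two_and.1

theorem insertIdx_cancel {L L' : List ℕ} {p q N : ℕ} (hp : p ≤ L.length) (hq : q ≤ L'.length)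
    (hL : N ∉ L) (hL' : N ∉ L') (h : L.insertIdx p N = L'.insertIdx q N) : p = q ∧ L = L' := by
  induction L generalizing p q L' with
  | nil =>
    obtain rfl : p = 0 := by simpa using hp
    cases q with
    | zero => simpa using h
    | succ q => cases L' <;> simp_all
  | cons x L ih =>
    cases p with
    | zero =>
      cases q with
      | zero => simpa using h
      | succ q => cases L' <;> simp_all
    | succ p =>
      cases L' with
      | nil =>
        obtain rfl : q = 0 := by simpa using hq
        simp_all
      | cons y L' =>
        cases q with
        | zero => simp_all
        | succ q =>
          simp only [List.insertIdx_succ_cons, List.cons.injEq] at h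
          have := ih (by simpa using hp) (by simpa using hq) (by simp_all) (by simp_all) h.2
          simp [this, h.1]

theorem succ_notMem (H : PartialMatching n A L) : n + 1 ∉ L := fun hx => by
  have := H.le_of_mem hx
  omega

theorem succ_notMem_block (H : PartialMatching n A L) {B : Finset ℕ} (hB : B ∈ A) :
    n + 1 ∉ B := fun hx => by
  have := H.le_of_mem_block hB hx
  omega

/-- Inversion with the list and the blocks as equations, so that two runs ending in the same data
can be compared. -/
theorem succ_cases (H : TableauRun (n + 1) A L w h) :
    (∃ L₀ w₀ h₀ p, TableauRun n A L₀ w₀ h₀ ∧ L = L₀.insertIdx p (n + 1) ∧ p ≤ L₀.length ∧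
      ((RowOneInsert w₀ p w ∧ h = (true, true) :: h₀) ∨
        RowTwoInsert w₀ p w ∧ h = (true, false) :: h₀)) ∨
    ∃ A₀ i c h₀, TableauRun n A₀ (i :: L) (c :: w) h₀ ∧ A = insert {i, n + 1} A₀ ∧
      h = (false, !c) :: h₀ := by
  cases H with
  | openOne H hi =>
    exact .inl ⟨_, _, _, _, H, rfl, H.sameProfile.length_eq ▸ hi.le_length, .inl ⟨hi, rfl⟩⟩
  | openTwo H hi =>
    exact .inl ⟨_, _, _, _, H, rfl, H.sameProfile.length_eq ▸ hi.le_length, .inr ⟨hi, rfl⟩⟩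
  | close H => exact .inr ⟨_, _, _, _, H, rfl, rfl⟩

/-- A partial matching determines the tableau and its history. -/
theorem tableau_unique {w' h'} (H : TableauRun n A L w h) (H' : TableauRun n A L w' h') :
    w = w' ∧ h = h' := by
  induction n generalizing A L w h w' h' with
  | zero => cases H; cases H'; simp
  | succ n ih =>
    rcases H.succ_cases with ⟨L₀, w₀, h₀, p, H₀, rfl, hp, hi⟩ | ⟨A₀, i, c, h₀, H₀, rfl, rfl⟩ <;>
    rcases H'.succ_cases with ⟨L₁, w₁, h₁, q, H₁, hL, hq, hi'⟩ | ⟨A₁, j, d, h₁, H₁, hA, rfl⟩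
    · obtain ⟨rfl, rfl⟩ := insertIdx_cancel hp hq (succ_notMem H₀.partialMatching)
        (succ_notMem H₁.partialMatching) hL
      obtain ⟨rfl, rfl⟩ := ih H₀ H₁
      rcases hi with ⟨hi, rfl⟩ | ⟨hi, rfl⟩ <;> rcases hi' with ⟨hi', rfl⟩ | ⟨hi', rfl⟩
      · exact ⟨hi.target_unique hi', rfl⟩
      · exact (hi.not_rowTwoInsert hi').elim
      · exact (hi'.not_rowTwoInsert hi).elim
      · exact ⟨hi.target_unique hi', rfl⟩
    -- One run opens `n + 1` and the other closes a block containing it, while opening leaves the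
    -- blocks within the first `n` positions.
    · exact (succ_notMem_block H₀.partialMatching (B := {j, n + 1}) (by simp [hA]) (by simp)).elim
    · exact (succ_notMem_block H₁.partialMatching (Finset.mem_insert_self _ _) (by simp)).elim
    · have hmem : ({i, n + 1} : Finset ℕ) ∈ insert {j, n + 1} A₁ := hA ▸ Finset.mem_insert_self _ _
      have hB : ({i, n + 1} : Finset ℕ) = {j, n + 1} :=
        (Finset.mem_insert.1 hmem).resolve_right fun hB =>
          succ_notMem_block H₁.partialMatching hB (by simp)
      have hi := H₀.partialMatching.le_of_mem (x := i) (by simp)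
      have hij : i ∈ ({j, n + 1} : Finset ℕ) := hB ▸ by simp
      obtain rfl : i = j := by
        simp only [Finset.mem_insert, Finset.mem_singleton] at hij
        omega
      obtain rfl : A₀ = A₁ := by
        have h₀ : {i, n + 1} ∉ A₀ := fun hB => succ_notMem_block H₀.partialMatching hB (by simp)
        have h₁ : {i, n + 1} ∉ A₁ := fun hB => succ_notMem_block H₁.partialMatching hB (by simp)
        rw [← Finset.erase_insert h₀, hA, Finset.erase_insert h₁]
      have := ih H₀ H₁
      simp_all

/-- The tableau and its history determine the partial matching. -/
theorem matching_unique {A' L'} (H : TableauRun n A L w h) (H' : TableauRun n A' L' w h) :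
    A = A' ∧ L = L' := by
  induction n generalizing A L w h A' L' with
  | zero => cases H; cases H'; simp
  | succ n ih =>
    rcases H.succ_cases with ⟨L₀, w₀, h₀, p, H₀, rfl, hp, ⟨hi, rfl⟩ | ⟨hi, rfl⟩⟩ |
      ⟨A₀, i, c, h₀, H₀, rfl, rfl⟩ <;>
    rcases H'.succ_cases with ⟨L₁, w₁, h₁, q, H₁, rfl, hq, ⟨hi', hh⟩ | ⟨hi', hh⟩⟩ |
      ⟨A₁, j, d, h₁, H₁, rfl, hh⟩ <;>
    -- The latest step of the history tells the kind of move, so only the three matching pairs of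
    -- cases remain.
    simp only [List.cons.injEq, Prod.mk.injEq, reduceCtorEq, true_and, and_false,
      false_and, Bool.not_inj_iff] at hh
    · obtain ⟨rfl, rfl⟩ := hi.source_unique hi'
      subst hh
      obtain ⟨rfl, rfl⟩ := ih H₀ H₁
      simp
    · obtain ⟨rfl, rfl⟩ := hi.source_unique hi'
      subst hh
      obtain ⟨rfl, rfl⟩ := ih H₀ H₁
      simp
    · obtain ⟨rfl, rfl⟩ := hh
      have := ih H₀ H₁
      simp_all

end TableauRun

/-- Position `n + 1` is either pending or closed, so the last move can be undone. In the pending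
case, absence of a 3-crossing makes the first `p` openers decrease, and through the profile this
makes the insertion possible. -/
theorem PartialMatching.exists_tableauRun {n : ℕ} {A : Finset (Finset ℕ)} {L : List ℕ}
    (hm : PartialMatching n A L) (hc : ¬ CompletedCrossing 3 n A L) :
    ∃ w h, TableauRun n A L w h := by
  induction n generalizing A L with
  | zero =>
    have hL : L = [] := List.eq_nil_iff_forall_not_mem.2 fun x hx => by
      have := (hm.mem_iff x).1 (.inl hx)
      omega
    have hA : A = ∅ := Finset.eq_empty_iff_forall_notMem.2 fun B hB => by
      obtain ⟨x, hx⟩ := Finset.card_pos.1 (hm.card B hB ▸ two_pos)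
      have := (hm.mem_iff x).1 (.inr ⟨B, hB, hx⟩)
      omega
    subst hL hA
    exact ⟨_, _, .nil⟩
  | succ n ih =>
    rcases (hm.mem_iff (n + 1)).2 (by omega) with hn | ⟨B, hB, hn⟩
    · obtain ⟨p, L', hp, rfl, hm'⟩ := hm.exists_open hn
      rw [completedCrossing_open hm' hp, hasIncreasing_two hm'.nodup] at hc
      push Not at hc
      obtain ⟨w, h, H⟩ := ih hm' hc.1
      rcases exists_insert_of_truesFirst (H.sameProfile.length_eq ▸ hp)
        ((H.sameProfile.take_iff p).1 hc.2) with ⟨w', hi⟩ | ⟨w', hi⟩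
      · exact ⟨_, _, H.openOne hi⟩
      · exact ⟨_, _, H.openTwo hi⟩
    · obtain ⟨i, A', rfl, hm'⟩ := hm.exists_close hB hn
      rw [completedCrossing_close (hm'.le_of_mem (by simp))] at hc
      obtain ⟨w, h, H⟩ := ih hm' hc
      match w, H.sameProfile with
      | c :: w, _ => exact ⟨_, _, H.close⟩

/-- Runs the process backwards from an arbitrary tableau of the final shape; the generality in `w`
is needed since earlier tableaux are not empty. -/
theorem NoncrossingHistory.exists_tableauRun {h : List (Bool × Bool)} (hh : NoncrossingHistory h)
    {w : List Bool} (hw : Ballot w) (h₁ : excess (h.map Prod.fst) = w.length)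
    (h₂ : excess (h.map Prod.snd) = excess w) :
    ∃ A L, TableauRun h.length A L w h := by
  induction h generalizing w with
  | nil =>
    obtain rfl : w = [] := by simpa [excess, eq_comm] using h₁
    exact ⟨_, _, .nil⟩
  | cons s h ih =>
    obtain ⟨hh, h3, h4⟩ := hh
    -- The bounds before the last step keep the restored word ballot when a closing is undone, and
    -- provide a nonempty second row or a strictly longer first row when an insertion is undone.
    have h5 : 0 ≤ excess (h.map Prod.snd) ∧
        excess (h.map Prod.snd) ≤ excess (h.map Prod.fst) := by
      cases h with
      | nil => simp [excess]
      | cons s h => exact hh.2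
    have h6 := hw.excess_nonneg
    have h7 := excess_le_length w
    obtain ⟨a, b⟩ := s
    cases a <;> cases b <;> simp [excess, stepSign] at h₁ h₂ h3 h4
    · obtain ⟨A, L, H⟩ := ih hh (w := true :: w) ⟨hw, by simp [excess, stepSign]; omega⟩
        (by simp; omega) (by simp [excess, stepSign]; omega)
      match L, H.sameProfile with
      | i :: L, _ => exact ⟨_, _, H.close⟩
    · obtain ⟨A, L, H⟩ := ih hh (w := false :: w) ⟨hw, by simp [excess, stepSign]; omega⟩
        (by simp; omega) (by simp [excess, stepSign]; omega)
      match L, H.sameProfile with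
      | i :: L, _ => exact ⟨_, _, H.close⟩
    · obtain ⟨s, p, hs, hi⟩ := exists_rowTwoInsert hw (by omega)
      have := hi.length_eq
      have := hi.excess_eq
      obtain ⟨A, L, H⟩ := ih hh hs (by omega) (by omega)
      exact ⟨_, _, H.openTwo hi⟩
    · obtain ⟨s, p, hs, hi⟩ := exists_rowOneInsert hw (by omega)
      have := hi.length_eq
      have := hi.excess_eq
      obtain ⟨A, L, H⟩ := ih hh hs (by omega) (by omega)
      exact ⟨_, _, H.openOne hi⟩

/-! ### Dyck paths as words -/

/-- The up-down word of the first `n` steps of a sequence of heights, most recent step first. -/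
def stepWord (y : ℕ → ℤ) : ℕ → List Bool
  | 0 => []
  | n + 1 => decide (y n < y (n + 1)) :: stepWord y n

theorem length_stepWord (y : ℕ → ℤ) (n : ℕ) : (stepWord y n).length = n := by
  induction n <;> simp_all [stepWord]

theorem excess_stepWord {y : ℕ → ℤ} {n : ℕ} (h0 : y 0 = 0)
    (hs : ∀ t < n, y (t + 1) = y t + 1 ∨ y (t + 1) = y t - 1) : excess (stepWord y n) = y n := by
  induction n with
  | zero => simp [stepWord, excess, h0]
  | succ n ih =>
    have := ih fun t ht => hs t (by omega)
    rcases hs n (by omega) with h | h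
    · simp [stepWord, excess, stepSign, this, h, add_comm]
    · have hlt : ¬ y n < y n - 1 := by omega
      simp [stepWord, excess, stepSign, this, h, hlt]
      omega

/-- With the latest step first, dropping all but the last `t` letters leaves the first `t` steps, so
the excess is the height at time `t`. -/
theorem stepWord_excess_drop (l : List Bool) :
    stepWord (fun t => excess (l.drop (l.length - t))) l.length = l := by
  have key : ∀ n ≤ l.length, stepWord (fun t => excess (l.drop (l.length - t))) n =
      l.drop (l.length - n) := by
    intro n hn
    induction n with
    | zero => simp [stepWord]
    | succ n ih =>
      have h1 : l.drop (l.length - (n + 1)) =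
          l[l.length - (n + 1)] :: l.drop (l.length - n) := by
        rw [List.drop_eq_getElem_cons (by omega)]
        congr 2
        omega
      simp only [stepWord, ih (by omega), h1]
      cases l[l.length - (n + 1)] <;> simp [excess, stepSign]
  simpa using key l.length le_rfl

theorem excess_drop_step (l : List Bool) {t : ℕ} (ht : t < l.length) :
    excess (l.drop (l.length - (t + 1))) = excess (l.drop (l.length - t)) + 1 ∨
      excess (l.drop (l.length - (t + 1))) = excess (l.drop (l.length - t)) - 1 := by
  rw [List.drop_eq_getElem_cons (by omega), show l.length - (t + 1) + 1 = l.length - t by omega]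
  cases l[l.length - (t + 1)] <;> simp [excess, stepSign] <;> omega

namespace DyckPath

variable {m : ℕ}

/-- The ordinate of the `t`-th point of a Dyck path. -/
def height (P : DyckPath m) (t : ℕ) : ℤ :=
  if h : t < 2 * m + 1 then (P.point ⟨t, h⟩).2 else 0

theorem height_coe (P : DyckPath m) (t : Fin (2 * m + 1)) : P.height t = (P.point t).2 :=
  dif_pos t.2

theorem height_zero (P : DyckPath m) : P.height 0 = 0 := by
  have := P.height_coe 0
  rwa [P.origin] at this

theorem height_last (P : DyckPath m) : P.height (2 * m) = 0 := by
  have := P.height_coe (Fin.last _)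
  rwa [P.destination] at this

theorem height_nonneg (P : DyckPath m) (t : ℕ) : 0 ≤ P.height t := by
  unfold height
  split_ifs
  · exact P.nonneg _
  · exact le_rfl

theorem height_step (P : DyckPath m) {t : ℕ} (ht : t < 2 * m) :
    P.height (t + 1) = P.height t + 1 ∨ P.height (t + 1) = P.height t - 1 := by
  have h1 := P.height_coe (Fin.succ ⟨t, ht⟩)
  have h2 := P.height_coe (Fin.castSucc ⟨t, ht⟩)
  simp only [Fin.val_succ, Fin.val_castSucc] at h1 h2
  rw [h1, h2]
  rcases P.step ⟨t, ht⟩ with h | h <;> rw [h] <;> simp [sub_eq_add_neg]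

theorem point_fst (P : DyckPath m) (t : Fin (2 * m + 1)) : (P.point t).1 = (t : ℕ) := by
  induction t using Fin.induction with
  | zero => simp [P.origin]
  | succ t ih => rcases P.step t with h | h <;> rw [h] <;> simp_all

theorem ext_height {P Q : DyckPath m} (h : ∀ t ≤ 2 * m, P.height t = Q.height t) : P = Q := by
  have : P.point = Q.point := by
    funext t
    refine Prod.ext (by rw [point_fst, point_fst]) ?_
    rw [← height_coe, ← height_coe, h t (by omega)]
  cases P
  cases Q
  simpa using this

/-- The up-down word of a Dyck path, last step first. -/
def word (P : DyckPath m) : List Bool := stepWord P.height (2 * m)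

theorem length_word (P : DyckPath m) : P.word.length = 2 * m := length_stepWord _ _

theorem excess_stepWord_height (P : DyckPath m) {n : ℕ} (hn : n ≤ 2 * m) :
    excess (stepWord P.height n) = P.height n :=
  excess_stepWord P.height_zero fun _ ht => P.height_step (by omega)

theorem word_injective : Function.Injective (word : DyckPath m → List Bool) := by
  intro P Q h
  -- Shorter step words are tails of longer ones, hence the downward induction; their excesses
  -- recover every height.
  have key : ∀ {y z : ℕ → ℤ} {n : ℕ}, stepWord y n = stepWord z n →
      ∀ t ≤ n, stepWord y t = stepWord z t := by
    intro y z n h t ht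
    induction ht using Nat.decreasingInduction with
    | self => exact h
    | of_succ t _ ih =>
      simp only [stepWord, List.cons.injEq] at ih
      exact ih.2
  refine ext_height fun t ht => ?_
  rw [← P.excess_stepWord_height ht, ← Q.excess_stepWord_height ht, key h t ht]

theorem exists_word_eq {l : List Bool} (hl : l.length = 2 * m) (h0 : excess l = 0)
    (hn : ∀ k, 0 ≤ excess (l.drop k)) :
    ∃ P : DyckPath m, P.word = l ∧
      ∀ t : Fin (2 * m + 1), (P.point t).2 = excess (l.drop (2 * m - t)) := by
  let P : DyckPath m :=
    { point := fun t => (((t : ℕ) : ℤ), excess (l.drop (2 * m - t)))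
      origin := by simp [← hl, excess]
      destination := by simp [h0]
      step := fun t => by
        have := excess_drop_step l (t := t) (by omega)
        rw [hl] at this
        rcases this with h | h <;> simp [h, sub_eq_add_neg]
      nonneg := fun t => hn _ }
  refine ⟨P, ?_, fun t => rfl⟩
  have key : ∀ n ≤ 2 * m, stepWord P.height n =
      stepWord (fun t => excess (l.drop (l.length - t))) n := by
    have hh : ∀ t ≤ 2 * m, P.height t = excess (l.drop (l.length - t)) := fun t ht => by
      rw [height, dif_pos (by omega), hl]
    intro n hn
    induction n with
    | zero => rfl
    | succ n ih => simp only [stepWord, ih (by omega), hh n (by omega), hh (n + 1) hn]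
  rw [word, key _ le_rfl, ← hl, stepWord_excess_drop]

end DyckPath

theorem NoncrossingHistory.drop {h : List (Bool × Bool)} (hh : NoncrossingHistory h) (k : ℕ) :
    NoncrossingHistory (h.drop k) := by
  induction h generalizing k with
  | nil => simpa using hh
  | cons s h ih =>
    cases k with
    | zero => exact hh
    | succ k => exact ih hh.1 k

theorem NoncrossingHistory.excess_le {h : List (Bool × Bool)} (hh : NoncrossingHistory h) :
    0 ≤ excess (h.map Prod.snd) ∧ excess (h.map Prod.snd) ≤ excess (h.map Prod.fst) := by
  cases h with
  | nil => simp [excess]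
  | cons s h => exact hh.2

/-- The history of a pair of Dyck paths. -/
def DyckPath.history {m : ℕ} (P Q : DyckPath m) : List (Bool × Bool) := P.word.zip Q.word

theorem DyckPath.map_history {m : ℕ} (P Q : DyckPath m) :
    (P.history Q).map Prod.fst = P.word ∧ (P.history Q).map Prod.snd = Q.word := by
  constructor
  · exact List.map_fst_zip (by simp [DyckPath.length_word])
  · exact List.map_snd_zip (by simp [DyckPath.length_word])

theorem DyckPath.noncrossingHistory {m : ℕ} {P Q : DyckPath m}
    (h : ∀ t, (Q.point t).2 ≤ (P.point t).2) : NoncrossingHistory (P.history Q) := by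
  have key : ∀ n ≤ 2 * m,
      NoncrossingHistory ((stepWord P.height n).zip (stepWord Q.height n)) := by
    intro n hn
    induction n with
    | zero => trivial
    | succ n ih =>
      refine ⟨ih (by omega), ?_⟩
      change 0 ≤ excess (((stepWord P.height (n + 1)).zip (stepWord Q.height (n + 1))).map _) ∧
        excess (((stepWord P.height (n + 1)).zip (stepWord Q.height (n + 1))).map _) ≤
        excess (((stepWord P.height (n + 1)).zip (stepWord Q.height (n + 1))).map _)
      rw [List.map_snd_zip (by simp [length_stepWord]), List.map_fst_zip (by simp [length_stepWord]),
        P.excess_stepWord_height hn, Q.excess_stepWord_height hn]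
      refine ⟨Q.height_nonneg _, ?_⟩
      have := h ⟨n + 1, by omega⟩
      rwa [← height_coe, ← height_coe] at this
  exact key _ le_rfl

theorem NoncrossingHistory.exists_dyckPath {m : ℕ} {h : List (Bool × Bool)}
    (hh : NoncrossingHistory h) (hl : h.length = 2 * m) (h0 : excess (h.map Prod.fst) = 0) :
    ∃ P Q : DyckPath m, P.history Q = h ∧ ∀ t, (Q.point t).2 ≤ (P.point t).2 := by
  have hd := fun k => (hh.drop k).excess_le
  simp only [List.map_drop] at hd
  have := hh.excess_le
  obtain ⟨P, hP, hP'⟩ := DyckPath.exists_word_eq (m := m) (l := h.map Prod.fst) (by simpa) h0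
    fun k => (hd k).1.trans (hd k).2
  obtain ⟨Q, hQ, hQ'⟩ := DyckPath.exists_word_eq (m := m) (l := h.map Prod.snd) (by simpa)
    (by omega) fun k => (hd k).1
  refine ⟨P, Q, ?_, fun t => ?_⟩
  · rw [DyckPath.history, hP, hQ, List.zip_map', List.map_id'']
    simp
  · rw [hP', hQ']
    exact (hd _).2

/-! ### The correspondence for complete matchings -/

section Matching

variable {m : ℕ}

theorem IsCompleteMatching.partialMatching {M : Finpartition (groundSet m)}
    (h : IsCompleteMatching M) : PartialMatching (2 * m) M.parts [] where
  card := h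
  disjoint B hB C hC x hxB hxC := M.eq_of_mem_parts hB hC hxB hxC
  mem_iff x := by
    rw [← Finset.mem_Icc]
    simp only [List.not_mem_nil, false_or]
    exact ⟨fun ⟨B, hB, hx⟩ => M.le hB hx, fun hx => M.exists_mem hx⟩
  nodup := List.nodup_nil
  notMem := by simp

theorem PartialMatching.exists_finpartition {A : Finset (Finset ℕ)}
    (h : PartialMatching (2 * m) A []) :
    ∃ M : Finpartition (groundSet m), M.parts = A ∧ IsCompleteMatching M := by
  refine ⟨⟨A, ?_, ?_, ?_⟩, rfl, h.card⟩
  · rw [Finset.supIndep_iff_pairwiseDisjoint]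
    exact fun B hB C hC hBC => Finset.disjoint_left.2 fun x hx hx' =>
      hBC (h.disjoint B hB C hC x hx hx')
  · ext x
    have := h.mem_iff x
    simp only [List.not_mem_nil, false_or] at this
    simp [Finset.mem_sup, this]
  · intro hA
    simpa using h.card _ hA

/-- With no pending openers, completion adds nothing. -/
theorem completedCrossing_parts_iff {k : ℕ} (M : Finpartition (groundSet m)) :
    CompletedCrossing k (2 * m) M.parts [] ↔ HasCrossing k M := by
  simp [CompletedCrossing, HasCrossing, CompletedArc, IsArc]

/-- The matching `M` corresponds to the pair `(P, Q)`. -/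
def Corresponds (M : Finpartition (groundSet m)) (P Q : DyckPath m) : Prop :=
  TableauRun (2 * m) M.parts [] [] (P.history Q)

theorem history_injective {P Q P' Q' : DyckPath m} (h : P.history Q = P'.history Q') :
    P = P' ∧ Q = Q' :=
  ⟨DyckPath.word_injective (by rw [← (P.map_history Q).1, h, (P'.map_history Q').1]),
    DyckPath.word_injective (by rw [← (P.map_history Q).2, h, (P'.map_history Q').2])⟩

theorem Corresponds.unique_pair {M : Finpartition (groundSet m)} {P Q P' Q' : DyckPath m}
    (h : Corresponds M P Q) (h' : Corresponds M P' Q') : P = P' ∧ Q = Q' :=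
  history_injective (h.tableau_unique h').2

theorem Corresponds.unique_matching {M M' : Finpartition (groundSet m)} {P Q : DyckPath m}
    (h : Corresponds M P Q) (h' : Corresponds M' P Q) : M = M' :=
  Finpartition.ext (h.matching_unique h').1

theorem exists_corresponds_of_matching {M : Finpartition (groundSet m)}
    (h : IsCompleteMatching M) (hc : ¬ HasCrossing 3 M) :
    ∃ P Q : DyckPath m, Corresponds M P Q ∧ ∀ t, (Q.point t).2 ≤ (P.point t).2 := by
  rw [← completedCrossing_parts_iff] at hc
  obtain ⟨w, h, H⟩ := h.partialMatching.exists_tableauRun hc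
  -- With no opener pending the final tableau is empty, so both paths end at height `0`.
  match w, H.sameProfile with
  | [], _ =>
    obtain ⟨P, Q, rfl, hPQ⟩ := H.noncrossingHistory.exists_dyckPath H.length_history
      (by simpa using H.heights.1)
    exact ⟨P, Q, H, hPQ⟩

theorem exists_corresponds_of_pair {P Q : DyckPath m}
    (h : ∀ t, (Q.point t).2 ≤ (P.point t).2) :
    ∃ M : Finpartition (groundSet m), Corresponds M P Q ∧ IsCompleteMatching M ∧
      ¬ HasCrossing 3 M := by
  have hP : excess P.word = 0 := (P.excess_stepWord_height le_rfl).trans P.height_last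
  have hQ : excess Q.word = 0 := (Q.excess_stepWord_height le_rfl).trans Q.height_last
  obtain ⟨A, L, H⟩ := (DyckPath.noncrossingHistory h).exists_tableauRun (w := []) trivial
    (by simpa [(P.map_history Q).1] using hP)
    (by simpa [(P.map_history Q).2, excess] using hQ)
  have hl : (P.history Q).length = 2 * m := by
    rw [← List.length_map (f := Prod.fst), (P.map_history Q).1, P.length_word]
  rw [hl] at H
  obtain rfl : L = [] := by simpa using H.sameProfile.length_eq
  obtain ⟨M, rfl, hM⟩ := H.partialMatching.exists_finpartition
  exact ⟨M, H, hM, fun hc =>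
    H.not_completedCrossing_three ((completedCrossing_parts_iff M).2 hc)⟩

theorem Corresponds.hasCrossing_two_iff {M : Finpartition (groundSet m)} {P Q : DyckPath m}
    (h : Corresponds M P Q) : HasCrossing 2 M ↔ P ≠ Q := by
  rw [← completedCrossing_parts_iff, h.completedCrossing_two, ← not_iff_not]
  push Not
  constructor
  · intro hs
    refine DyckPath.word_injective ?_
    rw [← (P.map_history Q).1, ← (P.map_history Q).2]
    exact List.map_congr_left hs
  · rintro rfl s hs
    have hz : P.history P = P.word.map fun a => (a, a) := by
      simpa [DyckPath.history] using List.zip_map' (f := id) (g := id) (l := P.word)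
    rw [hz] at hs
    obtain ⟨a, -, rfl⟩ := List.mem_map.1 hs
    rfl

theorem not_hasCrossing_three_of_two {M : Finpartition (groundSet m)} (h : ¬ HasCrossing 2 M) :
    ¬ HasCrossing 3 M := by
  rintro ⟨i, j, hij, hi, hlt, hj⟩
  exact h ⟨i ∘ Fin.castSucc, j ∘ Fin.castSucc, fun r => hij _, hi.comp Fin.strictMono_castSucc,
    fun r s => hlt _ _, hj.comp Fin.strictMono_castSucc⟩

end Matching

theorem corollary5p2 (m : ℕ) :
    (∃ f : NoncrossingMatching 2 m → DyckPath m, Function.Bijective f) ∧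
    (∃ g : NoncrossingMatching 3 m → NoncrossingDyckPair m, Function.Bijective g) := by
  constructor
  · have key : ∀ M : NoncrossingMatching 2 m, ∃ P : DyckPath m, Corresponds M.1 P P := by
      intro M
      obtain ⟨P, Q, h, -⟩ :=
        exists_corresponds_of_matching M.2.1 (not_hasCrossing_three_of_two M.2.2)
      -- Distinct paths would force a 2-crossing.
      obtain rfl : P = Q := by
        by_contra hPQ
        exact M.2.2 (h.hasCrossing_two_iff.2 hPQ)
      exact ⟨P, h⟩
    choose f hf using key
    refine ⟨f, fun M M' h => Subtype.ext ((hf M).unique_matching (h ▸ hf M')), fun P => ?_⟩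
    obtain ⟨M, h, hM, -⟩ := exists_corresponds_of_pair (P := P) (Q := P) fun _ => le_rfl
    exact ⟨⟨M, hM, fun hc => h.hasCrossing_two_iff.1 hc rfl⟩, ((hf _).unique_pair h).1⟩
  · have key : ∀ M : NoncrossingMatching 3 m, ∃ PQ : NoncrossingDyckPair m,
        Corresponds M.1 PQ.1.1 PQ.1.2 := by
      intro M
      obtain ⟨P, Q, h, hPQ⟩ := exists_corresponds_of_matching M.2.1 M.2.2
      exact ⟨⟨(P, Q), hPQ⟩, h⟩
    choose g hg using key
    refine ⟨g, fun M M' h => Subtype.ext ((hg M).unique_matching (h ▸ hg M')), fun PQ => ?_⟩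
    obtain ⟨M, h, hM⟩ := exists_corresponds_of_pair PQ.2
    have := (hg ⟨M, hM⟩).unique_pair h
    exact ⟨⟨M, hM⟩, Subtype.ext (Prod.ext this.1 this.2)⟩
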